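/- Let $D\ge 2$ be the size of a finite alphabet $\mathcal A$, let $n\ge 1$, and let $U_n=(1/n,\dots,1/n)$ be the uniform distribution on $n$ symbols. Trees are finite rooted trees in which every node has at most $D$ children, drawn so that children are ordered from left to right; the level of a node is its distance from the root. Define $T_U$ as follows. If $n=D^m$ with $m\ge 0$, then $T_U$ is the tree in which every internal node has $D$ children and all $D^m$ leaves are at level $m$. If $D^m<n<D^{m+1}$ with $m\ge 0$, then $T_U$ is the tree with $n$ leaves such that (i) all leaves are at levels $m$ and $m+1$; (ii) at level $m$, each internal node is to the right of every leaf; (iii) every internal node, except possibly the leftmost internal node at level $m$, has $D$ children, and the leftmost internal node at level $m$ has at least $2$ children. The $D$-ary Huffman algorithm for $(p_1,\dots,p_n)$ starts from the forest of $n$ isolated vertices with probabilities $p_1,\dots,p_n$. In the first step it chooses $k$ vertices having the lowest $k$ probabilities, where $2\le k\le D$ and $D-1$ divides $n-k$; in each later step it chooses $D$ roots having the lowest $D$ probabilities. The chosen roots receive a new common parent, which becomes a root with probability the sum of theirs. It stops when the forest is a tree (at once if $n=1$). A tree that can be produced in this way, for some choices among equal probabilities, is a Huffman tree for $(p_1,\dots,p_n)$;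 the left-to-right order of siblings is immaterial. A prefix code over $\mathcal A$ assigns to the $n$ symbols words over $\mathcal A$ such that none is a prefix of the word of another symbol. If the $i$th word has length $l_i$, its expected length for $(p_1,\dots,p_n)$ is $\sum_i p_i l_i$; the code is optimal if this is minimal among all prefix codes over $\mathcal A$ for the $n$ symbols. The length sequence of a code (of a tree) is the list of its codeword lengths (of the levels of its leaves) in non-decreasing order. **Theorem.** The tree $T_U$ exists and is unique, and it is a Huffman tree for $U_n$. Moreover, if $m\ge 0$ is the integer with $D^m\le n<D^{m+1}$, then the length sequence of $T_U$ is $$(\underbrace{m,\dots,m}_{a},\underbrace{m+1,\dots,m+1}_{n-a}),\qquad a=D^m-\left\lceil\frac{n-D^m}{D-1}\right\rceil ,$$ and a sequence is the length sequence of an optimal prefix code over $\mathcal A$ for $U_n$ if and only if it is this sequence (for $n=D^m$ it is $(m,\dots,m)$). -/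

import Mathlib

/-! ### Prefix codes and optimal length sequences -/

/-- An assignment of codewords over the alphabet `A` to the `n` source symbols is a prefix code if
no codeword is a prefix of the codeword of another symbol. -/
def IsPrefixCode {A : Type*} {n : ℕ} (c : Fin n → List A) : Prop :=
  ∀ i j, c i <+: c j → i = j

/-- The expected length `∑ pᵢ lᵢ` of a code. -/
noncomputable def expectedLength {A : Type*} {n : ℕ} (p : Fin n → ℝ) (c : Fin n → List A) : ℝ :=
  ∑ i, p i * ((c i).length : ℝ)

/-- A prefix code of minimum expected length among all prefix codes over the alphabet `A`. -/
def IsOptimalCode {A : Type*} {n : ℕ} (p : Fin n → ℝ) (c : Fin n → List A) : Prop :=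
  IsPrefixCode c ∧ ∀ c' : Fin n → List A, IsPrefixCode c' → expectedLength p c ≤ expectedLength p c'

/-- The codeword lengths arranged in non-decreasing order. -/
def codeLengthSequence {A : Type*} {n : ℕ} (c : Fin n → List A) : List ℕ :=
  (List.ofFn fun i => (c i).length : Multiset ℕ).sort (· ≤ ·)

/-- `L` is the length sequence of an optimal code over the alphabet `A`. -/
def IsOptimalLengthSequence (A : Type*) {n : ℕ} (p : Fin n → ℝ) (L : List ℕ) : Prop :=
  ∃ c : Fin n → List A, IsOptimalCode p c ∧ codeLengthSequence c = L

/-- The uniform distribution `(1/n, …, 1/n)`. -/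
noncomputable def uniformDist (n : ℕ) : Fin n → ℝ := fun _ => 1 / (n : ℝ)

/-! ### Finite rooted trees, drawn in the plane -/

/-- A finite rooted tree; the children of each node are listed from left to right.
A node without children is a leaf. -/
inductive PlaneTree : Type
  | node (children : List PlaneTree) : PlaneTree

namespace PlaneTree

/-- The tree with one node. -/
def leaf : PlaneTree := node []

/-- The subtrees hanging at the children of the root, from left to right. -/
def children : PlaneTree → List PlaneTree
  | node ts => ts

/-- The root is a leaf. -/
def IsLeaf (t : PlaneTree) : Prop := t.children = []

/-- The nodes at level `k`, from left to right (each given by the subtree of its descendants). -/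
def nodesAt : ℕ → PlaneTree → List PlaneTree
  | 0, t => [t]
  | k + 1, t => t.children.flatMap (nodesAt k)

/-- The internal nodes at level `k`, from left to right. -/
def internalAt (k : ℕ) (t : PlaneTree) : List PlaneTree :=
  (nodesAt k t).filter fun s => !s.children.isEmpty

mutual

/-- The levels of the leaves from left to right, when the root is counted as being at level `d`. -/
def leafLevelsFrom : ℕ → PlaneTree → List ℕ
  | d, node [] => [d]
  | d, node (t :: ts) => leafLevelsFrom (d + 1) t ++ forestLeafLevelsFrom (d + 1) ts

/-- The same for a list of trees all of whose roots are counted as being at level `d`. -/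
def forestLeafLevelsFrom : ℕ → List PlaneTree → List ℕ
  | _, [] => []
  | d, t :: ts => leafLevelsFrom d t ++ forestLeafLevelsFrom d ts

end

/-- The levels of the leaves, from left to right; one entry for each leaf. -/
def leafLevels (t : PlaneTree) : List ℕ := leafLevelsFrom 0 t

/-- The number of leaves. -/
def numLeaves (t : PlaneTree) : ℕ := t.leafLevels.length

/-- The levels of the leaves in non-decreasing order. -/
def lengthSequence (t : PlaneTree) : List ℕ := (t.leafLevels : Multiset ℕ).sort (· ≤ ·)

/-- The tree with all its `D ^ m` leaves at level `m`, each internal node having `D` children. -/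
def full (D : ℕ) : ℕ → PlaneTree
  | 0 => leaf
  | m + 1 => node (List.replicate D (full D m))

/-- The conditions on a tree with `n` leaves for `D ^ m < n < D ^ (m + 1)`. -/
structure IsTwoLevel (D m n : ℕ) (T : PlaneTree) : Prop where
  /-- `T` has `n` leaves. -/
  numLeaves_eq : T.numLeaves = n
  /-- No node has more than `D` children. -/
  arity : ∀ k, ∀ t ∈ T.nodesAt k, t.children.length ≤ D
  /-- All leaves are at levels `m` and `m + 1`. -/
  leaf_level : ∀ l ∈ T.leafLevels, l = m ∨ l = m + 1
  /-- At level `m` every internal node is to the right of every leaf: nothing to the right of an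
  internal node is a leaf. -/
  internal_right : (T.nodesAt m).Pairwise fun s t => ¬ s.IsLeaf → ¬ t.IsLeaf
  /-- Internal nodes at the other levels have `D` children. -/
  full_of_ne : ∀ k, k ≠ m → ∀ t ∈ T.internalAt k, t.children.length = D
  /-- Internal nodes at level `m`, apart from the leftmost one, have `D` children. -/
  full_of_not_leftmost : ∀ t ∈ (T.internalAt m).tail, t.children.length = D
  /-- The leftmost internal node at level `m` has at least two children. -/
  leftmost : ∀ t ∈ (T.internalAt m).head?, 2 ≤ t.children.length

/-- `T` is the tree `T_U` for `n` leaves and arity `D`. -/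
def IsUniformTree (D n : ℕ) (T : PlaneTree) : Prop :=
  ∃ m : ℕ, (n = D ^ m ∧ T = full D m) ∨ (D ^ m < n ∧ n < D ^ (m + 1) ∧ IsTwoLevel D m n T)

end PlaneTree

/-! ### The Huffman algorithm -/

/-- A forest in which each tree carries the probability of its root. -/
abbrev WeightedForest : Type := Multiset (ℝ × PlaneTree)

/-- One step of the algorithm: some `k` roots having the `k` lowest probabilities (the list `S`; `R`
are the other trees of the forest) get a common parent, which becomes a root and receives the sum of
their probabilities. The left-to-right order of the new siblings is arbitrary. -/
inductive HuffmanMerge (k : ℕ) : WeightedForest → WeightedForest → Prop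
  | merge (S : List (ℝ × PlaneTree)) (R : WeightedForest) (card_eq : S.length = k)
      (lowest : ∀ s ∈ S, ∀ r ∈ R, s.1 ≤ r.1) :
      HuffmanMerge k ((S : WeightedForest) + R)
        (((S.map Prod.fst).sum, PlaneTree.node (S.map Prod.snd)) ::ₘ R)

/-- The initial forest: `n` isolated vertices with the probabilities `p 0, …, p (n - 1)`. -/
noncomputable def initialForest {n : ℕ} (p : Fin n → ℝ) : WeightedForest :=
  Finset.univ.val.map fun i => (p i, PlaneTree.leaf)

/-- `T` can be generated by the `D`-ary Huffman algorithm on `p`: the first step merges `k` roots,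
where `2 ≤ k ≤ D` and `D - 1` divides `n - k`, and every further step merges `D` roots, until the
forest is a tree. For `n = 1` the initial forest is already a tree. -/
def IsHuffmanTree (D : ℕ) {n : ℕ} (p : Fin n → ℝ) (T : PlaneTree) : Prop :=
  (n = 1 ∧ T = PlaneTree.leaf) ∨
  ∃ (k : ℕ) (F : WeightedForest) (w : ℝ), 2 ≤ k ∧ k ≤ D ∧ ((D : ℤ) - 1 ∣ (n : ℤ) - (k : ℤ)) ∧
    HuffmanMerge k (initialForest p) F ∧ Relation.ReflTransGen (HuffmanMerge D) F {(w, T)}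

/-! ### The Kraft inequality and the optimal lengths for the uniform distribution -/

-- For the uniform distribution an optimal code minimises the total length S of its words. Scale
-- Kraft's inequality by D^(m+1). By convexity, l ↦ D^(m+1-l) lies at every natural number on or
-- above the line through its values D at m and 1 at m+1 (`tangent_le_inv_pow`). Summing, with n =
-- D^m + r, gives S - nm ≥ rD/(D-1) = r + r/(D-1), so S ≥ nm + r + c with c = ⌈r/(D-1)⌉. A length
-- outside {m, m+1} would add at least D-2+1/D to the scaled sum, but rounding up to c frees at most
-- D-2; hence equality leaves only these two lengths (`le_sum_of_kraft`), and the sum then fixes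
-- their multiplicities. Extending words of length m by one letter attains the bound
-- (`exists_isPrefixCode_two_lengths`).
--
-- For n ≥ 2 write n = p + j + qD with p + 1 + q = D^M and 2 ≤ j ≤ D (`exists_level_counts`). Then
-- T_U is the tree that is D-regular below level M and has at level M, from left to right, p leaves,
-- a star with j leaves and q stars with D leaves (`isUniformTree_iff`); a power of D is the case p
-- = 0, j = D. A tree regular below M is determined by its row at level M (`RegularBelow.ext`),
-- whence uniqueness.
--
-- Existence and the Huffman property come from one construction (`exists_isHuffmanTree`). The first
-- merge makes the j-star and the next q merges the D-stars, leaving D^M roots with weights in an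
-- interval [w, Dw]. When such a sorted list is merged D at a time, each new parent weighs at least
-- Dw, so no parent is needed before the level is used up; the parents are again sorted, with
-- weights in [Dw, D(Dw)], and the argument repeats (`exists_huffmanMerge_level`).

theorem InformationTheory.uniquelyDecodable_of_prefix_free {A : Type*} {S : Set (List A)}
    (h0 : [] ∉ S) (h : ∀ u ∈ S, ∀ v ∈ S, u <+: v → u = v) : UniquelyDecodable S := by
  intro L₁
  induction L₁ with
  | nil =>
    intro L₂ _ h₂ he
    cases L₂ with
    | nil => rfl
    | cons v L₂ =>
      have : v = [] := by simp at he; exact he.1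
      exact absurd (this ▸ h₂ v (by simp)) h0
  | cons u L₁ ih =>
    intro L₂ h₁ h₂ he
    cases L₂ with
    | nil =>
      have : u = [] := by simp at he; exact he.1
      exact absurd (this ▸ h₁ u (by simp)) h0
    | cons v L₂ =>
      have hu := h₁ u (by simp)
      have hv := h₂ v (by simp)
      simp only [List.flatten_cons] at he
      -- Both first words are prefixes of the same concatenation, so one is a prefix of the other.
      have huv : u = v := by
        rcases List.prefix_or_prefix_of_prefix (List.prefix_append u L₁.flatten)
          (he ▸ List.prefix_append v L₂.flatten) with hp | hp
        · exact h u hu v hv hp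
        · exact (h v hv u hu hp).symm
      subst huv
      rw [List.append_cancel_left_eq] at he
      rw [ih L₂ (fun w hw => h₁ w (by simp [hw])) (fun w hw => h₂ w (by simp [hw])) he]

theorem IsPrefixCode.injective {A : Type*} {n : ℕ} {c : Fin n → List A} (hc : IsPrefixCode c) :
    Function.Injective c :=
  fun i j hij => hc i j (hij ▸ List.prefix_refl _)

/-- Kraft's inequality for prefix codes. -/
theorem IsPrefixCode.kraft {A : Type*} [Fintype A] [Nonempty A] {n : ℕ} {c : Fin n → List A}
    (hc : IsPrefixCode c) : ∑ i, (1 / (Fintype.card A : ℝ)) ^ (c i).length ≤ 1 := by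
  classical
  -- An empty codeword is a prefix of every word, so it is the only one; this case is excluded from
  -- unique decodability and treated directly.
  by_cases h0 : ∃ i, c i = []
  · obtain ⟨i, hi⟩ := h0
    have huniv : (Finset.univ : Finset (Fin n)) = {i} :=
      Finset.eq_singleton_iff_unique_mem.2
        ⟨Finset.mem_univ i, fun j _ => (hc i j (hi ▸ List.nil_prefix)).symm⟩
    rw [huniv, Finset.sum_singleton, hi]
    simp
  · push Not at h0
    have hS : InformationTheory.UniquelyDecodable
        ((Finset.univ.image c : Finset (List A)) : Set (List A)) := by
      apply InformationTheory.uniquelyDecodable_of_prefix_free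
      · simpa using h0
      · rintro u hu v hv huv
        simp only [Finset.coe_image, Finset.coe_univ, Set.image_univ, Set.mem_range] at hu hv
        obtain ⟨i, rfl⟩ := hu
        obtain ⟨j, rfl⟩ := hv
        rw [hc i j huv]
    have := InformationTheory.kraft_mcmillan_inequality hS
    rwa [Finset.sum_image fun i _ j _ hij => hc.injective hij] at this

/-- The tangent line of `l ↦ D ^ (-l)` through its values at `m` and `m + 1`. -/
theorem tangent_le_inv_pow {D : ℝ} (hD : 2 ≤ D) (m l : ℕ) :
    D - ((l : ℝ) - m) * (D - 1) ≤ D ^ (m + 1) * (1 / D) ^ l ∧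
    (l = m ∨ l = m + 1 ∨
      D - ((l : ℝ) - m) * (D - 1) + (D - 1) ^ 2 / D ≤ D ^ (m + 1) * (1 / D) ^ l) := by
  have hD0 : 0 < D := by linarith
  have hgap : 0 ≤ (D - 1) ^ 2 / D := by positivity
  -- This is the exact distance from the line at l = m + 2, the smallest one off {m, m + 1}.
  have hgap' : (D - 1) ^ 2 / D = D - 2 + 1 / D := by field_simp; ring
  have hinv : 1 / D ≤ 1 / 2 := one_div_le_one_div_of_le (by norm_num) hD
  rcases lt_trichotomy l m with hlm | rfl | hlm
  · obtain ⟨s, rfl⟩ := Nat.exists_eq_add_of_lt hlm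
    have hval : D ^ (l + s + 1 + 1) * (1 / D) ^ l = D ^ (s + 2) := by
      rw [one_div, inv_pow]; field_simp; ring
    have hmain : D + (s + 1) * (D - 1) + (D - 1) ^ 2 / D ≤ D ^ (s + 2) := by
      induction s with
      | zero => rw [hgap']; norm_num; rw [one_div] at hinv; nlinarith
      | succ s ih =>
        have ih := ih (by omega) (by rw [one_div, inv_pow]; field_simp; ring)
        have h1 : 1 ≤ D ^ (s + 2) := one_le_pow₀ (by linarith)
        have h2 : D ^ (s + 1 + 2) = D ^ (s + 2) * D := pow_succ D (s + 2)
        rw [h2]; push_cast; nlinarith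
    rw [hval]; push_cast
    exact ⟨by linarith, .inr (.inr (by linarith))⟩
  · have hval : D ^ (l + 1) * (1 / D) ^ l = D := by
      rw [one_div, inv_pow]; field_simp; ring
    rw [hval]
    exact ⟨by simp, .inl rfl⟩
  · obtain ⟨s, rfl⟩ := Nat.exists_eq_add_of_lt hlm
    rcases s with _ | _ | s
    · have hval : D ^ (m + 1) * (1 / D) ^ (m + 0 + 1) = 1 := by
        rw [one_div, inv_pow]; field_simp
      rw [hval]; push_cast
      exact ⟨by linarith, .inr (.inl rfl)⟩
    · have hval : D ^ (m + 1) * (1 / D) ^ (m + (0 + 1) + 1) = 1 / D := by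
        rw [one_div, inv_pow]; field_simp; ring
      rw [hval, hgap']; push_cast
      exact ⟨by nlinarith, .inr (.inr (by nlinarith))⟩
    · have hpos : 0 < D ^ (m + 1) * (1 / D) ^ (m + (s + 1 + 1) + 1) := by positivity
      have hs : 0 ≤ (s : ℝ) * (D - 1) := mul_nonneg (by positivity) (by linarith)
      rw [hgap']; push_cast
      exact ⟨by nlinarith, .inr (.inr (by nlinarith))⟩

/-- Integers satisfying Kraft's inequality have sum at least `n * m + (r + c)`, where
`n = D ^ m + r` and `c = ⌈r / (D - 1)⌉`; here `D = d + 1`. -/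
theorem le_sum_of_kraft {d m r c n : ℕ} (hd : 1 ≤ d) (hn : n = (d + 1) ^ m + r)
    (hc : c * d + 1 ≤ r + d) {l : Fin n → ℕ}
    (hl : ∑ i, (1 / ((d + 1 : ℕ) : ℝ)) ^ l i ≤ 1) :
    n * m + (r + c) ≤ ∑ i, l i ∧
      (∑ i, l i = n * m + (r + c) → ∀ i, l i = m ∨ l i = m + 1) := by
  have hD : (2 : ℝ) ≤ ((d + 1 : ℕ) : ℝ) := by exact_mod_cast Nat.succ_le_succ hd
  set D : ℝ := ((d + 1 : ℕ) : ℝ) with hDdef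
  have hD1 : D - 1 = d := by rw [hDdef]; push_cast; ring
  have hnD : (n : ℝ) = D ^ m + r := by rw [hn, hDdef]; push_cast; ring
  have hkraft : ∑ i, D ^ (m + 1) * (1 / D) ^ l i ≤ D ^ (m + 1) := by
    rw [← Finset.mul_sum]
    exact mul_le_of_le_one_right (by positivity) hl
  have hlin : ∑ i, (D - ((l i : ℝ) - m) * (D - 1)) =
      n * D - ((∑ i, l i : ℕ) - n * m : ℝ) * (D - 1) := by
    rw [Finset.sum_sub_distrib, ← Finset.sum_mul, Finset.sum_sub_distrib]
    simp
  constructor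
  · have h := (Finset.sum_le_sum fun i _ => (tangent_le_inv_pow hD m (l i)).1).trans hkraft
    rw [hlin, hD1] at h
    have h' : (r : ℝ) * (d + 1) ≤ ((∑ i, l i : ℕ) - n * m : ℝ) * d := by
      have : D = d + 1 := by linarith
      rw [hnD, this, pow_succ] at h
      rw [hnD, this]
      nlinarith
    have h'' : r * (d + 1) + n * m * d ≤ (∑ i, l i) * d := by
      have : (r * (d + 1) + n * m * d : ℝ) ≤ (∑ i, l i : ℕ) * d := by linarith
      exact_mod_cast this
    -- Integrality enters here: c * d < r + d rules out any total below n * m + (r + c).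
    by_contra hlt
    have : (∑ i, l i) * d + d ≤ (n * m + (r + c)) * d := by
      rw [← Nat.succ_mul]; exact Nat.mul_le_mul_right _ (by omega)
    nlinarith
  · intro hsum i
    rcases (tangent_le_inv_pow hD m (l i)).2 with h | h | h
    · exact .inl h
    · exact .inr h
    · exfalso
      -- One exceptional index contributes the whole gap D - 2 + 1/D, while `hc` bounds the
      -- available slack c * d - r by d - 1 = D - 2.
      have hlt : ∑ j, (D - ((l j : ℝ) - m) * (D - 1)) + (D - 1) ^ 2 / D ≤
          ∑ j, D ^ (m + 1) * (1 / D) ^ l j := by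
        rw [← Finset.add_sum_erase _ _ (Finset.mem_univ i),
          ← Finset.add_sum_erase _ (fun j => D ^ (m + 1) * (1 / D) ^ l j) (Finset.mem_univ i)]
        have := Finset.sum_le_sum fun j (_ : j ∈ Finset.univ.erase i) =>
          (tangent_le_inv_pow hD m (l j)).1
        linarith
      have h := hlt.trans hkraft
      rw [hlin, hsum] at h
      push_cast at h
      have hgap' : (D - 1) ^ 2 / D = D - 2 + 1 / D := by field_simp; ring
      have hpos : 0 < 1 / D := by positivity
      have hcr : (c * d + 1 : ℝ) ≤ r + d := by exact_mod_cast hc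
      have hd' : D = d + 1 := by linarith
      rw [hgap', hD1] at h
      have h1 : (n : ℝ) * D - (r + c) * d + (D - 2) < D ^ (m + 1) := by linarith
      rw [hnD, pow_succ] at h1
      rw [hd'] at h1
      nlinarith

-- Sequences with two consecutive values

theorem Multiset.eq_replicate_add_replicate {m : ℕ} (s : Multiset ℕ)
    (h : ∀ x ∈ s, x = m ∨ x = m + 1) :
    ∃ a b : ℕ, s = Multiset.replicate a m + Multiset.replicate b (m + 1) := by
  induction s using Multiset.induction with
  | empty => exact ⟨0, 0, by simp⟩
  | cons x s ih =>
    obtain ⟨a, b, rfl⟩ := ih fun y hy => h y (Multiset.mem_cons_of_mem hy)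
    rcases h x (Multiset.mem_cons_self _ _) with rfl | rfl
    · exact ⟨a + 1, b, by simp [Multiset.replicate_succ]⟩
    · exact ⟨a, b + 1, by simp [Multiset.replicate_succ]⟩

theorem Multiset.eq_replicate_add_replicate_of_sum {m a b : ℕ} {s : Multiset ℕ}
    (h : ∀ x ∈ s, x = m ∨ x = m + 1) (hcard : s.card = a + b)
    (hsum : s.sum = (a + b) * m + b) :
    s = Multiset.replicate a m + Multiset.replicate b (m + 1) := by
  obtain ⟨a', b', rfl⟩ := s.eq_replicate_add_replicate h
  simp only [Multiset.card_add, Multiset.card_replicate, Multiset.sum_add,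
    Multiset.sum_replicate, smul_eq_mul] at hcard hsum
  have hb : b' = b := by
    have : a' * m + b' * (m + 1) = (a' + b') * m + b' := by ring
    rw [this, hcard] at hsum
    omega
  have ha : a' = a := by omega
  rw [ha, hb]

theorem sort_coe_eq_replicate_append {m a b : ℕ} {l : List ℕ}
    (h : (l : Multiset ℕ) = Multiset.replicate a m + Multiset.replicate b (m + 1)) :
    (l : Multiset ℕ).sort (· ≤ ·) = List.replicate a m ++ List.replicate b (m + 1) := by
  have hs : (List.replicate a m ++ List.replicate b (m + 1)).Pairwise (· ≤ ·) := by
    rw [List.pairwise_append]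
    refine ⟨by simp [List.pairwise_replicate], by simp [List.pairwise_replicate], ?_⟩
    intro x hx y hy
    rw [List.eq_of_mem_replicate hx, List.eq_of_mem_replicate hy]
    omega
  rw [h]
  have : Multiset.replicate a m + Multiset.replicate b (m + 1) =
      ((List.replicate a m ++ List.replicate b (m + 1) : List ℕ) : Multiset ℕ) := by
    rw [← Multiset.coe_add, Multiset.coe_replicate, Multiset.coe_replicate]
  rw [this, Multiset.coe_sort]
  exact List.mergeSort_of_pairwise (by simpa using hs)

theorem expectedLength_uniformDist {A : Type*} {n : ℕ} (c : Fin n → List A) :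
    expectedLength (uniformDist n) c = 1 / (n : ℝ) * ((∑ i, (c i).length : ℕ) : ℝ) := by
  simp [expectedLength, uniformDist, Finset.mul_sum]

theorem expectedLength_uniformDist_le_iff {A : Type*} {n : ℕ} (hn : 1 ≤ n)
    (c c' : Fin n → List A) :
    expectedLength (uniformDist n) c ≤ expectedLength (uniformDist n) c' ↔
      ∑ i, (c i).length ≤ ∑ i, (c' i).length := by
  rw [expectedLength_uniformDist, expectedLength_uniformDist,
    mul_le_mul_iff_of_pos_left (by positivity), Nat.cast_le]

/-- A prefix code with `a` words of length `m` and `b` words of length `m + 1`. -/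
theorem exists_isPrefixCode_two_lengths {A : Type*} [Fintype A] {m a b c : ℕ}
    (hac : a + c = Fintype.card A ^ m) (hb : b ≤ c * Fintype.card A) :
    ∃ w : Fin (a + b) → List A, IsPrefixCode w ∧
      ∀ i, (w i).length = if i.1 < a then m else m + 1 := by
  classical
  -- All words of length m are enumerated: the first a are codewords, the last c are reserved as
  -- stems for the long codewords, and `f` picks distinct one-letter extensions of these stems.
  obtain ⟨e⟩ : Nonempty (Fin (a + c) ≃ (Fin m → A)) := ⟨Fintype.equivOfCardEq (by simp [hac])⟩
  obtain ⟨f⟩ : Nonempty (Fin b ↪ Fin c × A) :=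
    Function.Embedding.nonempty_of_card_le (by simpa using hb)
  let w : Fin a ⊕ Fin b → List A := Sum.elim
    (fun i => List.ofFn (e (Fin.castAdd c i)))
    (fun j => List.ofFn (e (Fin.natAdd a (f j).1)) ++ [(f j).2])
  have hpre : ∀ x y, w x <+: w y → x = y := by
    rintro (i | i) (j | j) h
    · have h := List.ofFn_injective (h.eq_of_length (by simp [w]))
      have := e.injective h
      simpa using this
    · exfalso
      have h1 : List.ofFn (e (Fin.castAdd c i)) <+: List.ofFn (e (Fin.natAdd a (f j).1)) :=
        List.prefix_of_prefix_length_le h (List.prefix_append _ _) (by simp)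
      have := e.injective (List.ofFn_injective (h1.eq_of_length (by simp)))
      simp [Fin.ext_iff] at this
      omega
    · have := h.length_le
      simp [w] at this
    · have h := h.eq_of_length (by simp [w])
      simp only [w, Sum.elim_inr] at h
      obtain ⟨h1, h2⟩ := List.append_inj h (by simp)
      have h1 := e.injective (List.ofFn_injective h1)
      congr 1
      apply f.injective
      ext1
      · simpa using h1
      · simpa using h2
  refine ⟨fun i => w (finSumFinEquiv.symm i), fun i j h => ?_, fun i => ?_⟩
  · exact finSumFinEquiv.symm.injective (hpre _ _ h)
  · refine Fin.addCases (fun i => ?_) (fun i => ?_) i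
    · simp [w]
    · simp [w]

theorem codeLengthSequence_eq {A : Type*} {m a b : ℕ} {w : Fin (a + b) → List A}
    (h : ∀ i, (w i).length = m ∨ (w i).length = m + 1)
    (hsum : ∑ i, (w i).length = (a + b) * m + b) :
    codeLengthSequence w = List.replicate a m ++ List.replicate b (m + 1) := by
  apply sort_coe_eq_replicate_append
  apply Multiset.eq_replicate_add_replicate_of_sum
  · intro x hx
    rw [Multiset.mem_coe, List.mem_ofFn] at hx
    obtain ⟨i, rfl⟩ := hx
    exact h i
  · simp
  · rw [Multiset.sum_coe, List.sum_ofFn, hsum]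

/-- The length sequences of the optimal codes for the uniform distribution. -/
theorem isOptimalLengthSequence_uniformDist_iff {A : Type*} [Fintype A] {d m r c a : ℕ}
    (hd : 1 ≤ d) (hA : Fintype.card A = d + 1) (hac : a + c = (d + 1) ^ m)
    (hrc : r ≤ c * d) (hcr : c * d + 1 ≤ r + d) (hn : 1 ≤ a + (r + c)) (L : List ℕ) :
    IsOptimalLengthSequence A (uniformDist (a + (r + c))) L ↔
      L = List.replicate a m ++ List.replicate (r + c) (m + 1) := by
  have hA' : Nonempty A := Fintype.card_pos_iff.1 (by omega)
  obtain ⟨w, hw, hwl⟩ := exists_isPrefixCode_two_lengths (A := A) (m := m) (b := r + c)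
    (hA ▸ hac) (by rw [hA]; nlinarith)
  have hwsum : ∑ i, (w i).length = (a + (r + c)) * m + (r + c) := by
    simp only [hwl]
    rw [Fin.sum_univ_add]
    simp
    ring
  have hwm : ∀ i, (w i).length = m ∨ (w i).length = m + 1 := by
    intro i; rw [hwl]; split_ifs <;> simp
  have hlow : ∀ w' : Fin (a + (r + c)) → List A, IsPrefixCode w' → _ := fun w' h =>
    le_sum_of_kraft (l := fun i => (w' i).length) hd (by rw [← hac]; ring) hcr (hA ▸ h.kraft)
  constructor
  · rintro ⟨w', ⟨hp, hopt⟩, rfl⟩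
    have hle := (expectedLength_uniformDist_le_iff hn _ _).1 (hopt w hw)
    rw [hwsum] at hle
    have hsum := le_antisymm hle (hlow w' hp).1
    exact codeLengthSequence_eq ((hlow w' hp).2 hsum) hsum
  · rintro rfl
    refine ⟨w, ⟨hw, fun w' hp => ?_⟩, codeLengthSequence_eq hwm hwsum⟩
    rw [expectedLength_uniformDist_le_iff hn, hwsum]
    exact (hlow w' hp).1

/-! ### Levels of plane trees -/

/-- Blocks of a common length can be cut apart again. With `f = children` this recovers a row of a
regular tree from the row beneath it. -/
theorem List.eq_of_flatMap_eq_of_length {α β : Type*} {f : α → List β} (hf : Function.Injective f)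
    {D : ℕ} : ∀ {l₁ l₂ : List α}, l₁.length = l₂.length → (∀ x ∈ l₁, (f x).length = D) →
      (∀ x ∈ l₂, (f x).length = D) → l₁.flatMap f = l₂.flatMap f → l₁ = l₂
  | [], [], _, _, _, _ => rfl
  | x :: l₁, y :: l₂, hl, h₁, h₂, h => by
    simp only [List.flatMap_cons] at h
    obtain ⟨hxy, hll⟩ := List.append_inj h (by rw [h₁ x (by simp), h₂ y (by simp)])
    rw [hf hxy, List.eq_of_flatMap_eq_of_length hf (by simpa using hl)
      (fun z hz => h₁ z (by simp [hz])) (fun z hz => h₂ z (by simp [hz])) hll]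

/-- Once `P` holds it holds everywhere to the right. This turns the condition that internal nodes
stand to the right of leaves into an explicit shape of the row. -/
theorem List.eq_replicate_append_filter {α : Type*} (a : α) (P : α → Bool) :
    ∀ {l : List α}, (l.Pairwise fun s t => P s = true → P t = true) →
      (∀ x ∈ l, P x = false → x = a) →
      ∃ p, l = List.replicate p a ++ l.filter P
  | [], _, _ => ⟨0, rfl⟩
  | x :: l, hl, ha => by
    rw [List.pairwise_cons] at hl
    cases hx : P x with
    | true =>
      refine ⟨0, ?_⟩
      have : l.filter P = l := List.filter_eq_self.2 fun y hy => hl.1 y hy hx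
      simp [hx, this]
    | false =>
      obtain ⟨p, hp⟩ := List.eq_replicate_append_filter a P hl.2 fun y hy => ha y (by simp [hy])
      refine ⟨p + 1, ?_⟩
      have hxa := ha x (by simp) hx
      simp only [List.replicate_succ, List.filter_cons, hx, List.cons_append]
      simpa [hxa] using hp

namespace PlaneTree

/-- The tree whose root has `j` children, all of them leaves. -/
def starTree (j : ℕ) : PlaneTree := node (List.replicate j leaf)

/-- Every node at a level below `m` has exactly `D` children. -/
def RegularBelow (D m : ℕ) (T : PlaneTree) : Prop :=
  ∀ k < m, ∀ t ∈ T.nodesAt k, t.children.length = D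

theorem children_injective : Function.Injective children := by
  rintro ⟨s⟩ ⟨t⟩ h
  exact congrArg node h

@[simp] theorem children_leaf : leaf.children = [] := rfl

@[simp] theorem children_starTree (j : ℕ) : (starTree j).children = List.replicate j leaf := rfl

theorem eq_leaf_of_children_eq_nil {t : PlaneTree} (h : t.children = []) : t = leaf :=
  children_injective h

theorem eq_starTree_of_forall_children {t : PlaneTree} (h : ∀ s ∈ t.children, s = leaf) :
    t = starTree t.children.length :=
  children_injective (List.eq_replicate_of_mem h)

@[simp] theorem nodesAt_zero (t : PlaneTree) : nodesAt 0 t = [t] := rfl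

theorem nodesAt_succ (k : ℕ) (t : PlaneTree) :
    nodesAt (k + 1) t = (nodesAt k t).flatMap children := by
  induction k generalizing t with
  | zero => simp [nodesAt]
  | succ k ih =>
    rw [nodesAt, show nodesAt (k + 1) t = t.children.flatMap (nodesAt k) from rfl,
      List.flatMap_assoc]
    exact List.flatMap_congr fun s _ => ih s

theorem RegularBelow.mono {D k m : ℕ} {T : PlaneTree} (h : RegularBelow D m T) (hk : k ≤ m) :
    RegularBelow D k T :=
  fun i hi => h i (hi.trans_le hk)

theorem RegularBelow.length_nodesAt {D m : ℕ} {T : PlaneTree} (h : RegularBelow D m T) :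
    (T.nodesAt m).length = D ^ m := by
  induction m with
  | zero => rfl
  | succ m ih =>
    rw [nodesAt_succ, List.length_flatMap,
      List.map_congr_left (g := fun _ => D) fun t ht => h m m.lt_succ_self t ht]
    simp [ih (h.mono m.le_succ), pow_succ]

/-- A tree which is regular below level `m` is determined by its nodes at level `m`. -/
theorem RegularBelow.ext {D m : ℕ} {T T' : PlaneTree} (h : RegularBelow D m T)
    (h' : RegularBelow D m T') (he : T.nodesAt m = T'.nodesAt m) : T = T' := by
  induction m with
  | zero => simpa using he
  | succ m ih =>
    refine ih (h.mono m.le_succ) (h'.mono m.le_succ) ?_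
    rw [nodesAt_succ, nodesAt_succ] at he
    refine List.eq_of_flatMap_eq_of_length children_injective ?_ (h m m.lt_succ_self)
      (h' m m.lt_succ_self) he
    rw [(h.mono m.le_succ).length_nodesAt, (h'.mono m.le_succ).length_nodesAt]

theorem forestLeafLevelsFrom_eq (d : ℕ) (ts : List PlaneTree) :
    forestLeafLevelsFrom d ts = ts.flatMap (leafLevelsFrom d) := by
  induction ts with
  | nil => simp [forestLeafLevelsFrom]
  | cons t ts ih => simp [forestLeafLevelsFrom, ih]

@[simp] theorem leafLevelsFrom_leaf (d : ℕ) : leafLevelsFrom d leaf = [d] := by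
  rw [leaf, leafLevelsFrom]

theorem leafLevelsFrom_of_children_ne_nil (d : ℕ) {t : PlaneTree} (h : t.children ≠ []) :
    leafLevelsFrom d t = t.children.flatMap (leafLevelsFrom (d + 1)) := by
  rcases t with ⟨_ | ⟨t, ts⟩⟩
  · exact absurd rfl h
  · simp [children, leafLevelsFrom, forestLeafLevelsFrom_eq]

theorem leafLevelsFrom_starTree (d : ℕ) {j : ℕ} (hj : j ≠ 0) :
    leafLevelsFrom d (starTree j) = List.replicate j (d + 1) := by
  rw [leafLevelsFrom_of_children_ne_nil _ (by simpa using hj), children_starTree]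
  clear hj
  induction j with
  | zero => rfl
  | succ j ih => simp [List.replicate_succ, ih]

/-- Every subtree contains a leaf no higher than its root; this later excludes nodes at level m + 2.
-/
theorem leafLevelsFrom_ne_nil_and_le (t : PlaneTree) :
    ∀ d, leafLevelsFrom d t ≠ [] ∧ ∀ l ∈ leafLevelsFrom d t, d ≤ l := by
  induction t using PlaneTree.rec
    (motive_2 := fun ts => ∀ t ∈ ts, ∀ d, leafLevelsFrom d t ≠ [] ∧
      ∀ l ∈ leafLevelsFrom d t, d ≤ l) with
  | node ts ih =>
    intro d
    rcases ts with _ | ⟨t, ts⟩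
    · simp [leafLevelsFrom]
    · rw [leafLevelsFrom_of_children_ne_nil _ (by simp [children])]
      refine ⟨?_, fun l hl => ?_⟩
      · have := (ih t (by simp) (d + 1)).1
        simp [children, this]
      · obtain ⟨s, hs, hl⟩ := List.mem_flatMap.1 hl
        exact (Nat.le_succ d).trans ((ih s hs (d + 1)).2 l hl)
  | nil => rename_i ht _; simp at ht
  | cons t ts iht ihts =>
    rename_i s hs d
    rcases List.mem_cons.1 hs with rfl | hs
    · exact iht d
    · exact ihts s hs d

theorem mem_leafLevelsFrom_of_mem_nodesAt {k d l : ℕ} {s t : PlaneTree} (hs : s ∈ nodesAt k t)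
    (hl : l ∈ leafLevelsFrom (d + k) s) : l ∈ leafLevelsFrom d t := by
  induction k generalizing d t with
  | zero =>
    rw [nodesAt_zero, List.mem_singleton] at hs
    exact hs ▸ hl
  | succ k ih =>
    obtain ⟨u, hu, hsu⟩ := List.mem_flatMap.1 hs
    rw [leafLevelsFrom_of_children_ne_nil _ (List.ne_nil_of_mem hu)]
    exact List.mem_flatMap.2 ⟨u, hu, ih hsu (by rwa [show d + 1 + k = d + (k + 1) by ring])⟩

/-- If there are no leaves below level `m`, the leaves are those of the subtrees at level `m`. -/
theorem leafLevelsFrom_eq_flatMap_nodesAt {m d : ℕ} {t : PlaneTree}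
    (h : ∀ k < m, ∀ s ∈ nodesAt k t, s.children ≠ []) :
    leafLevelsFrom d t = (nodesAt m t).flatMap (leafLevelsFrom (d + m)) := by
  induction m with
  | zero => simp
  | succ m ih =>
    rw [ih fun k hk => h k (hk.trans m.lt_succ_self), nodesAt_succ, List.flatMap_assoc]
    exact List.flatMap_congr fun s hs =>
      leafLevelsFrom_of_children_ne_nil _ (h m m.lt_succ_self s hs)

theorem RegularBelow.leafLevels_eq {D m : ℕ} {T : PlaneTree} (hD : D ≠ 0)
    (h : RegularBelow D m T) : T.leafLevels = (nodesAt m T).flatMap (leafLevelsFrom m) := by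
  have := leafLevelsFrom_eq_flatMap_nodesAt (d := 0) (t := T) (m := m) fun k hk s hs hnil =>
    hD (by rw [← h k hk s hs, hnil, List.length_nil])
  rwa [Nat.zero_add] at this

/-- `p` leaves, followed by a starTree with `j` leaves and by `q` stars with `D` leaves. -/
def levelList (D p j q : ℕ) : List PlaneTree :=
  List.replicate p leaf ++ starTree j :: List.replicate q (starTree D)

theorem leafLevels_of_nodesAt_eq_levelList {D m p j q : ℕ} {T : PlaneTree} (hD : D ≠ 0)
    (hj : j ≠ 0) (h : RegularBelow D m T) (hT : T.nodesAt m = levelList D p j q) :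
    T.leafLevels = List.replicate p m ++ List.replicate (j + q * D) (m + 1) := by
  have h1 : (List.replicate p leaf).flatMap (leafLevelsFrom m) = List.replicate p m := by
    rw [List.flatMap_replicate, leafLevelsFrom_leaf, List.flatten_replicate_singleton]
  have h2 : (List.replicate q (starTree D)).flatMap (leafLevelsFrom m) =
      List.replicate (q * D) (m + 1) := by
    rw [List.flatMap_replicate, leafLevelsFrom_starTree _ hD, List.flatten_replicate_replicate]
  rw [h.leafLevels_eq hD, hT, levelList, List.flatMap_append, List.flatMap_cons, h1, h2,
    leafLevelsFrom_starTree _ hj, List.replicate_add]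

/-! ### The tree for the uniform distribution -/

theorem regularBelow_full (D m : ℕ) : RegularBelow D m (full D m) := by
  induction m with
  | zero => intro k hk; omega
  | succ m ih =>
    intro k hk t ht
    rcases k with _ | k
    · rw [nodesAt_zero, List.mem_singleton] at ht
      simp [ht, full, children]
    · obtain ⟨s, hs, ht⟩ := List.mem_flatMap.1 ht
      rw [List.eq_of_mem_replicate hs] at ht
      exact ih k (by omega) t ht

theorem nodesAt_full (D m : ℕ) : (full D m).nodesAt m = List.replicate (D ^ m) leaf := by
  induction m with
  | zero => rfl
  | succ m ih =>
    rw [nodesAt, full, children, List.flatMap_replicate, ih, List.flatten_replicate_replicate,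
      pow_succ, mul_comm]

theorem nodesAt_full_succ (D m : ℕ) :
    (full D (m + 1)).nodesAt m = List.replicate (D ^ m) (starTree D) := by
  have h := regularBelow_full D (m + 1)
  refine List.eq_replicate_iff.2 ⟨(h.mono m.le_succ).length_nodesAt, fun t ht => ?_⟩
  rw [← h m m.lt_succ_self t ht]
  refine eq_starTree_of_forall_children fun s hs => ?_
  have : s ∈ (full D (m + 1)).nodesAt (m + 1) := by
    rw [nodesAt_succ]; exact List.mem_flatMap.2 ⟨t, ht, hs⟩
  rw [nodesAt_full] at this
  exact List.eq_of_mem_replicate this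

/-- Subtracting the two equations leaves (j - 1) + q(D - 1), and 1 ≤ j - 1 ≤ D - 1 makes this a
division with unique quotient and shifted remainder. -/
theorem eq_of_level_counts {D p j q p' j' q' : ℕ} (hj : 2 ≤ j) (hjD : j ≤ D) (hj' : 2 ≤ j')
    (hjD' : j' ≤ D) (h : p + 1 + q = p' + 1 + q') (hn : p + j + q * D = p' + j' + q' * D) :
    p = p' ∧ j = j' ∧ q = q' := by
  have hq : q = q' := by
    rcases lt_trichotomy q q' with hlt | heq | hlt
    · obtain ⟨s, rfl⟩ := Nat.exists_eq_add_of_lt hlt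
      nlinarith [Nat.zero_le (s * (D - 1)), Nat.le_mul_of_pos_right s (by omega : 0 < D)]
    · exact heq
    · obtain ⟨s, rfl⟩ := Nat.exists_eq_add_of_lt hlt
      nlinarith [Nat.zero_le (s * (D - 1)), Nat.le_mul_of_pos_right s (by omega : 0 < D)]
  subst hq
  omega

theorem IsTwoLevel.regularBelow {D m n : ℕ} {T : PlaneTree} (h : IsTwoLevel D m n T) :
    RegularBelow D m T := by
  intro k hk t ht
  refine h.full_of_ne k hk.ne t (List.mem_filter.2 ⟨ht, ?_⟩)
  by_contra hleaf
  have hnil : t.children = [] := by simpa using hleaf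
  have := h.leaf_level k (mem_leafLevelsFrom_of_mem_nodesAt (d := 0) ht (by
    rw [eq_leaf_of_children_eq_nil hnil]; simp))
  omega

theorem IsTwoLevel.eq_starTree {D m n : ℕ} {T : PlaneTree} (h : IsTwoLevel D m n T)
    {t : PlaneTree} (ht : t ∈ T.nodesAt m) : t = starTree t.children.length := by
  refine eq_starTree_of_forall_children fun s hs => eq_leaf_of_children_eq_nil ?_
  by_contra hne
  obtain ⟨u, us, hu⟩ := List.exists_cons_of_ne_nil hne
  have hmem : u ∈ T.nodesAt (m + 2) := by
    rw [nodesAt_succ, nodesAt_succ]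
    exact List.mem_flatMap.2 ⟨s, List.mem_flatMap.2 ⟨t, ht, hs⟩, by simp [hu]⟩
  obtain ⟨hne, hle⟩ := leafLevelsFrom_ne_nil_and_le u (m + 2)
  obtain ⟨l, hl⟩ := List.exists_mem_of_ne_nil _ hne
  have h1 := h.leaf_level l (mem_leafLevelsFrom_of_mem_nodesAt (d := 0) hmem
    (by rwa [Nat.zero_add]))
  have h2 := hle l hl
  omega

theorem IsTwoLevel.exists_nodesAt_eq {D m n : ℕ} {T : PlaneTree} (hD : 2 ≤ D) (hn : D ^ m < n)
    (h : IsTwoLevel D m n T) :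
    ∃ p j q, 2 ≤ j ∧ j ≤ D ∧ p + 1 + q = D ^ m ∧ n = p + j + q * D ∧
      T.nodesAt m = levelList D p j q := by
  have hreg := h.regularBelow
  obtain ⟨p, hp⟩ := List.eq_replicate_append_filter leaf
    (fun s : PlaneTree => !s.children.isEmpty) (l := T.nodesAt m)
    (h.internal_right.imp fun {s t} hst => by simpa [IsLeaf] using hst)
    (fun x _ hx => eq_leaf_of_children_eq_nil (by simpa using hx))
  change _ = _ ++ internalAt m T at hp
  have hcount : T.numLeaves = n := h.numLeaves_eq
  have hlen := hreg.length_nodesAt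
  have hmem : ∀ t ∈ internalAt m T, t = starTree t.children.length ∧ t.children.length ≤ D :=
    fun t ht => ⟨h.eq_starTree (List.mem_of_mem_filter ht),
      h.arity m t (List.mem_of_mem_filter ht)⟩
  have htail := h.full_of_not_leftmost
  have hhead := h.leftmost
  -- Without internal nodes at level m there would be exactly D ^ m leaves, against `hn`.
  rcases hI : internalAt m T with _ | ⟨t, ts⟩
  · rw [hI, List.append_nil] at hp
    rw [hp, List.length_replicate] at hlen
    rw [numLeaves, hreg.leafLevels_eq (by omega), hp, List.flatMap_replicate,
      leafLevelsFrom_leaf, List.flatten_replicate_singleton, List.length_replicate] at hcount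
    omega
  · rw [hI] at hp hmem htail hhead
    have hts : ts = List.replicate ts.length (starTree D) :=
      List.eq_replicate_of_mem fun s hs => by
        rw [(hmem s (by simp [hs])).1, htail s (by simpa using hs)]
    have hT : T.nodesAt m = levelList D p t.children.length ts.length := by
      rw [hp, levelList, ← (hmem t (by simp)).1, ← hts]
    have hj : 2 ≤ t.children.length := hhead t (by simp)
    refine ⟨p, t.children.length, ts.length, hj, (hmem t (by simp)).2, ?_, ?_, hT⟩
    · rw [hp] at hlen
      simp only [List.length_append, List.length_replicate, List.length_cons] at hlen
      omega
    · rw [numLeaves, leafLevels_of_nodesAt_eq_levelList (by omega) (by omega) hreg hT] at hcount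
      simp only [List.length_append, List.length_replicate] at hcount
      omega

theorem isTwoLevel_of_nodesAt_eq {D m p j q : ℕ} {T : PlaneTree} (hj : 2 ≤ j) (hjD : j ≤ D)
    (h : RegularBelow D m T) (hT : T.nodesAt m = levelList D p j q) :
    IsTwoLevel D m (p + j + q * D) T := by
  have hlev := leafLevels_of_nodesAt_eq_levelList (by omega) (by omega) h hT
  have hmem : ∀ t ∈ T.nodesAt m, t = leaf ∨ t = starTree j ∨ t = starTree D := by
    intro t ht
    rw [hT, levelList, List.mem_append, List.mem_cons, List.mem_replicate,
      List.mem_replicate] at ht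
    tauto
  have hsucc : ∀ t ∈ T.nodesAt (m + 1), t = leaf := by
    intro t ht
    rw [nodesAt_succ] at ht
    obtain ⟨s, hs, ht⟩ := List.mem_flatMap.1 ht
    rcases hmem s hs with rfl | rfl | rfl
    · simp at ht
    · exact List.eq_of_mem_replicate ht
    · exact List.eq_of_mem_replicate ht
  have hnil : ∀ k, T.nodesAt (m + 2 + k) = [] := by
    intro k
    induction k with
    | zero =>
      rw [Nat.add_zero, nodesAt_succ, List.flatMap_eq_nil_iff]
      intro t ht
      rw [hsucc t ht, children_leaf]
    | succ k ih => rw [← Nat.add_assoc, nodesAt_succ, ih, List.flatMap_nil]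
  have hint : T.internalAt m = starTree j :: List.replicate q (starTree D) := by
    have hj0 : ¬ j = 0 := by omega
    have hD0 : ¬ D = 0 := by omega
    rw [internalAt, hT, levelList]
    simp [hj0, hD0]
  refine ⟨?_, ?_, ?_, ?_, ?_, ?_, ?_⟩
  · rw [numLeaves, hlev]; simp; omega
  · intro k t ht
    rcases lt_trichotomy k m with hk | rfl | hk
    · exact (h k hk t ht).le
    · rcases hmem t ht with rfl | rfl | rfl <;> simp [hjD]
    · obtain ⟨s, rfl⟩ := Nat.exists_eq_add_of_lt hk
      rcases s with _ | s
      · rw [hsucc t ht]; simp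
      · rw [show m + (s + 1) + 1 = m + 2 + s by ring, hnil] at ht
        simp at ht
  · intro l hl
    rw [hlev, List.mem_append, List.mem_replicate, List.mem_replicate] at hl
    tauto
  · rw [hT, levelList, List.pairwise_append, List.pairwise_cons, List.pairwise_replicate,
      List.pairwise_replicate]
    have hj0 : ¬ j = 0 := by omega
    have hD0 : ¬ D = 0 := by omega
    refine ⟨.inr id, ⟨?_, .inr id⟩, ?_⟩
    · intro t ht _
      rw [List.eq_of_mem_replicate ht]
      simpa [IsLeaf] using hD0
    · intro s hs t _ hsl
      rw [List.eq_of_mem_replicate hs] at hsl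
      exact absurd rfl hsl
  · intro k hk t ht
    obtain ⟨ht, hne⟩ := List.mem_filter.1 ht
    rcases lt_or_gt_of_ne hk with hk | hk
    · exact h k hk t ht
    · obtain ⟨s, rfl⟩ := Nat.exists_eq_add_of_lt hk
      rcases s with _ | s
      · rw [hsucc t ht] at hne; simp at hne
      · rw [show m + (s + 1) + 1 = m + 2 + s by ring, hnil] at ht
        simp at ht
  · intro t ht
    rw [hint, List.tail_cons] at ht
    rw [List.eq_of_mem_replicate ht]; simp
  · intro t ht
    rw [hint] at ht
    simp only [List.head?_cons, Option.mem_def, Option.some.injEq] at ht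
    rw [← ht]; simpa using hj

theorem isUniformTree_one_iff {D : ℕ} (hD : 2 ≤ D) (T : PlaneTree) :
    IsUniformTree D 1 T ↔ T = leaf := by
  constructor
  · rintro ⟨m, ⟨h, rfl⟩ | ⟨h, -, -⟩⟩
    · rcases m with _ | m
      · rfl
      · have := Nat.one_lt_pow (Nat.succ_ne_zero m) hD
        exact absurd h this.ne
    · have := Nat.one_le_pow m D (by omega)
      omega
  · rintro rfl
    exact ⟨0, .inl ⟨rfl, rfl⟩⟩

/-- `T_U` is described by its nodes at the last level without further levels of full width. -/
theorem isUniformTree_iff {D M p j q : ℕ} (hj : 2 ≤ j) (hjD : j ≤ D) (hpq : p + 1 + q = D ^ M)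
    (T : PlaneTree) :
    IsUniformTree D (p + j + q * D) T ↔
      RegularBelow D M T ∧ T.nodesAt M = levelList D p j q := by
  have hD : 2 ≤ D := hj.trans hjD
  have hlow : D ^ M < p + j + q * D := by nlinarith
  have hup : p + j + q * D ≤ D ^ (M + 1) := by rw [pow_succ, ← hpq]; nlinarith
  -- The upper bound is attained only if every node at level M has D children; this is where the
  -- full tree, of height M + 1, fits the same description.
  have hfull : p + j + q * D = D ^ (M + 1) → p = 0 ∧ j = D ∧ q + 1 = D ^ M := by
    intro h
    rw [pow_succ, ← hpq] at h
    have hp : p = 0 := by nlinarith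
    subst hp
    exact ⟨rfl, by linarith, by omega⟩
  have hnodes : p + j + q * D = D ^ (M + 1) →
      (full D (M + 1)).nodesAt M = levelList D p j q := by
    intro h
    obtain ⟨rfl, rfl, hq⟩ := hfull h
    rw [nodesAt_full_succ, ← hq, levelList, List.replicate_succ]; rfl
  constructor
  · rintro ⟨m, ⟨h, rfl⟩ | ⟨h1, h2, hT⟩⟩
    · have h1 : M < m := (Nat.pow_lt_pow_iff_right hD).1 (h ▸ hlow)
      have h2 : m ≤ M + 1 := (Nat.pow_le_pow_iff_right hD).1 (h ▸ hup)
      obtain rfl : m = M + 1 := by omega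
      exact ⟨(regularBelow_full D _).mono M.le_succ, hnodes h⟩
    · have h3 : M < m + 1 := (Nat.pow_lt_pow_iff_right hD).1 (hlow.trans h2)
      have h4 : m < M + 1 := (Nat.pow_lt_pow_iff_right hD).1 (h1.trans_le hup)
      obtain rfl : m = M := by omega
      obtain ⟨p', j', q', hj', hjD', hpq', hn, hT'⟩ := hT.exists_nodesAt_eq hD h1
      obtain ⟨rfl, rfl, rfl⟩ := eq_of_level_counts hj hjD hj' hjD' (hpq.trans hpq'.symm) hn
      exact ⟨hT.regularBelow, hT'⟩
  · rintro ⟨hreg, hT⟩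
    rcases hup.lt_or_eq with hlt | heq
    · exact ⟨M, .inr ⟨hlow, hlt, isTwoLevel_of_nodesAt_eq hj hjD hreg hT⟩⟩
    · exact ⟨M + 1, .inl ⟨heq, hreg.ext ((regularBelow_full D _).mono M.le_succ)
        (hT.trans (hnodes heq).symm)⟩⟩

end PlaneTree

/-! ### The Huffman algorithm on a level of subtrees -/

open Relation PlaneTree

theorem HuffmanMerge.of_eq {k : ℕ} {F G : WeightedForest} (S : List (ℝ × PlaneTree))
    (R : WeightedForest) (card_eq : S.length = k) (lowest : ∀ s ∈ S, ∀ r ∈ R, s.1 ≤ r.1)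
    (hF : F = (S : WeightedForest) + R)
    (hG : G = ((S.map Prod.fst).sum, PlaneTree.node (S.map Prod.snd)) ::ₘ R) :
    HuffmanMerge k F G := by
  subst hF hG
  exact .merge S R card_eq lowest

theorem List.le_sum_of_forall_le_length_mul {D : ℕ} (hD : 0 < D) {l : List ℝ} (hl : l.length = D)
    {u : ℝ} (h : ∀ x ∈ l, u ≤ D * x) : u ≤ l.sum := by
  have hD' : (0 : ℝ) < D := by exact_mod_cast hD
  have := List.card_nsmul_le_sum l (u / D) fun y hy => (div_le_iff₀' hD').2 (h y hy)
  rwa [hl, nsmul_eq_mul, mul_div_cancel₀ _ hD'.ne'] at this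

theorem List.sum_le_of_forall_length_mul_le {D : ℕ} (hD : 0 < D) {l : List ℝ} (hl : l.length = D)
    {u : ℝ} (h : ∀ x ∈ l, D * x ≤ u) : l.sum ≤ u := by
  have hD' : (0 : ℝ) < D := by exact_mod_cast hD
  have := List.sum_le_card_nsmul l (u / D) fun y hy => (le_div_iff₀' hD').2 (h y hy)
  rwa [hl, nsmul_eq_mul, mul_div_cancel₀ _ hD'.ne'] at this

/-- Merging the trees of a sorted list, `D` at a time, in the presence of heavier trees `P`. -/
theorem exists_huffmanMerge_chunks {D : ℕ} (hD : 0 < D) (w : ℝ) :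
    ∀ (K : ℕ) (L : List (ℝ × PlaneTree)) (P : WeightedForest), L.length = K * D →
    L.Pairwise (fun x y => x.1 ≤ y.1) → (∀ x ∈ L, w ≤ x.1 ∧ x.1 ≤ D * w) →
    (∀ x ∈ L, ∀ y ∈ P, x.1 ≤ y.1) →
    ∃ L' : List (ℝ × PlaneTree), L'.length = K ∧
      ReflTransGen (HuffmanMerge D) ((L : WeightedForest) + P) ((L' : WeightedForest) + P) ∧
      L'.Pairwise (fun x y => x.1 ≤ y.1) ∧
      (∀ u, (∀ x ∈ L, u ≤ D * x.1) → ∀ x ∈ L', u ≤ x.1) ∧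
      (∀ u, (∀ x ∈ L, D * x.1 ≤ u) → ∀ x ∈ L', x.1 ≤ u) ∧
      (∀ x ∈ L', x.2.children.length = D) ∧
      L'.flatMap (fun x => x.2.children) = L.map Prod.snd
  | 0, L, P, hlen, _, _, _ => by
    obtain rfl : L = [] := List.length_eq_zero_iff.1 (by simpa using hlen)
    exact ⟨[], rfl, .refl, .nil, by simp, by simp, by simp, by simp⟩
  | K + 1, L, P, hlen, hsort, hw, hP => by
    obtain ⟨S, L₁, rfl, hS⟩ : ∃ S L₁, L = S ++ L₁ ∧ S.length = D :=
      ⟨L.take D, L.drop D, (List.take_append_drop D L).symm, by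
        rw [List.length_take, hlen, Nat.min_eq_left]; nlinarith⟩
    have hL₁ : L₁.length = K * D := by
      rw [List.length_append, hS, Nat.succ_mul] at hlen; omega
    rw [List.pairwise_append] at hsort
    simp only [List.mem_append] at hw hP
    set σ : ℝ := (S.map Prod.fst).sum with hσ
    have hlow : ∀ u, (∀ x ∈ S, u ≤ D * x.1) → u ≤ σ := fun u hu =>
      List.le_sum_of_forall_le_length_mul hD (by simpa using hS) (by
        intro y hy
        obtain ⟨x, hx, rfl⟩ := List.mem_map.1 hy
        exact hu x hx)
    have hupp : ∀ u, (∀ x ∈ S, D * x.1 ≤ u) → σ ≤ u := fun u hu =>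
      List.sum_le_of_forall_length_mul_le hD (by simpa using hS) (by
        intro y hy
        obtain ⟨x, hx, rfl⟩ := List.mem_map.1 hy
        exact hu x hx)
    have hDw : D * w ≤ σ := hlow _ fun x hx =>
      mul_le_mul_of_nonneg_left (hw x (.inl hx)).1 (Nat.cast_nonneg D)
    -- The new parent joins the heavy trees `P`: its weight is at least D * w, which bounds
    -- everything still unmerged.
    obtain ⟨L', hlen', hmerge, hsort', hlow', hupp', hch, hflat⟩ :=
      exists_huffmanMerge_chunks hD w K L₁ ((σ, node (S.map Prod.snd)) ::ₘ P) hL₁ hsort.2.1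
        (fun x hx => hw x (.inr hx)) (by
          intro x hx y hy
          rcases Multiset.mem_cons.1 hy with rfl | hy
          · exact (hw x (.inr hx)).2.trans hDw
          · exact hP x (.inr hx) y hy)
    refine ⟨(σ, node (S.map Prod.snd)) :: L', by simp [hlen'], ?_, ?_, ?_, ?_, ?_, ?_⟩
    · refine .head (.of_eq S ((L₁ : WeightedForest) + P) hS ?_ ?_ rfl) ?_
      · intro s hs r hr
        rcases Multiset.mem_add.1 hr with hr | hr
        · exact hsort.2.2 s hs r hr
        · exact hP s (.inl hs) r hr
      · rw [← Multiset.coe_add, add_assoc]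
      · rw [← Multiset.cons_coe, Multiset.cons_add, ← Multiset.add_cons, ← Multiset.add_cons]
        exact hmerge
    · refine List.pairwise_cons.2 ⟨fun x hx => ?_, hsort'⟩
      -- The parents stay sorted: σ is at most D times each remaining weight, and the lower-bound
      -- clause passes this on to every later parent.
      refine hlow' σ (fun y hy => hupp _ fun s hs => ?_) x hx
      exact mul_le_mul_of_nonneg_left (hsort.2.2 s hs y hy) (Nat.cast_nonneg D)
    · intro u hu x hx
      rcases List.mem_cons.1 hx with rfl | hx
      · exact hlow u fun s hs => hu s (List.mem_append_left _ hs)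
      · exact hlow' u (fun s hs => hu s (List.mem_append_right _ hs)) x hx
    · intro u hu x hx
      rcases List.mem_cons.1 hx with rfl | hx
      · exact hupp u fun s hs => hu s (List.mem_append_left _ hs)
      · exact hupp' u (fun s hs => hu s (List.mem_append_right _ hs)) x hx
    · intro x hx
      rcases List.mem_cons.1 hx with rfl | hx
      · simpa [children] using hS
      · exact hch x hx
    · rw [List.flatMap_cons, hflat, List.map_append]
      rfl

/-- A sorted list of `D ^ M` trees with weights between `w` and `D * w` is merged into a tree that
has them at level `M`, in the same order. -/
theorem exists_huffmanMerge_level {D : ℕ} (hD : 0 < D) :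
    ∀ (M : ℕ) (w : ℝ) (L : List (ℝ × PlaneTree)), L.length = D ^ M →
    L.Pairwise (fun x y => x.1 ≤ y.1) → (∀ x ∈ L, w ≤ x.1 ∧ x.1 ≤ D * w) →
    ∃ (W : ℝ) (T : PlaneTree), ReflTransGen (HuffmanMerge D) (L : WeightedForest) {(W, T)} ∧
      RegularBelow D M T ∧ T.nodesAt M = L.map Prod.snd
  | 0, w, L, hlen, _, _ => by
    obtain ⟨x, rfl⟩ := List.length_eq_one_iff.1 hlen
    exact ⟨x.1, x.2, .refl, fun k hk => absurd hk (Nat.not_lt_zero k), rfl⟩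
  | M + 1, w, L, hlen, hsort, hw => by
    obtain ⟨L', hlen', hmerge, hsort', hlow, hupp, hch, hflat⟩ :=
      exists_huffmanMerge_chunks hD w (D ^ M) L 0 hlen hsort hw (by simp)
    obtain ⟨W, T, hT, hreg, hnodes⟩ := exists_huffmanMerge_level hD M (D * w) L' hlen' hsort'
      fun x hx => ⟨hlow _ (fun y hy => mul_le_mul_of_nonneg_left (hw y hy).1 (Nat.cast_nonneg D))
          x hx,
        hupp _ (fun y hy => mul_le_mul_of_nonneg_left (hw y hy).2 (Nat.cast_nonneg D)) x hx⟩
    rw [add_zero, add_zero] at hmerge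
    refine ⟨W, T, hmerge.trans hT, ?_, ?_⟩
    · intro k hk t ht
      rcases Nat.lt_succ_iff_lt_or_eq.1 hk with hk | rfl
      · exact hreg k hk t ht
      · rw [hnodes] at ht
        obtain ⟨x, hx, rfl⟩ := List.mem_map.1 ht
        exact hch x hx
    · rw [nodesAt_succ, hnodes, List.flatMap_map, hflat]

/-- Merging equal leaves `D` at a time. -/
theorem huffmanMerge_replicate_leaf (D : ℕ) (x : ℝ) : ∀ (q : ℕ) (P : WeightedForest),
    (∀ y ∈ P, x ≤ y.1) → x ≤ D * x →
    ReflTransGen (HuffmanMerge D) (Multiset.replicate (q * D) (x, leaf) + P)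
      (Multiset.replicate q (D * x, starTree D) + P)
  | 0, P, _, _ => by simpa using ReflTransGen.refl
  | q + 1, P, hP, hx => by
    refine .head (.of_eq (List.replicate D (x, leaf)) (Multiset.replicate (q * D) (x, leaf) + P)
      (by simp) ?_ ?_ rfl) ?_
    · intro s hs r hr
      rw [List.eq_of_mem_replicate hs]
      rcases Multiset.mem_add.1 hr with hr | hr
      · rw [Multiset.eq_of_mem_replicate hr]
      · exact hP r hr
    · rw [Multiset.coe_replicate, ← add_assoc, ← Multiset.replicate_add, Nat.succ_mul, add_comm D]
    · have := huffmanMerge_replicate_leaf D x q ((D * x, starTree D) ::ₘ P)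
        (by
          intro y hy
          rcases Multiset.mem_cons.1 hy with rfl | hy
          · exact hx
          · exact hP y hy) hx
      rw [Multiset.replicate_succ, Multiset.cons_add, ← Multiset.add_cons]
      simpa [starTree] using this

theorem initialForest_uniformDist (n : ℕ) :
    initialForest (uniformDist n) = Multiset.replicate n (1 / (n : ℝ), leaf) := by
  simp [initialForest, uniformDist]

/-- The Huffman algorithm can produce the tree with a prescribed list of subtrees at level `M`. -/
theorem exists_isHuffmanTree {D M p j q : ℕ} (hj : 2 ≤ j) (hjD : j ≤ D)
    (hpq : p + 1 + q = D ^ M) :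
    ∃ T : PlaneTree, IsHuffmanTree D (uniformDist (p + j + q * D)) T ∧
      RegularBelow D M T ∧ T.nodesAt M = levelList D p j q := by
  set n := p + j + q * D with hn
  set x : ℝ := 1 / (n : ℝ) with hx
  have hx0 : 0 ≤ x := by positivity
  have hj1 : (1 : ℝ) ≤ j := by exact_mod_cast (by omega : 1 ≤ j)
  have hjD' : (j : ℝ) ≤ D := by exact_mod_cast hjD
  have hxj : x ≤ j * x := le_mul_of_one_le_left hx0 hj1
  have hjx : j * x ≤ D * x := mul_le_mul_of_nonneg_right hjD' hx0
  let L : List (ℝ × PlaneTree) :=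
    List.replicate p (x, leaf) ++ (j * x, starTree j) :: List.replicate q (D * x, starTree D)
  have hmem : ∀ y ∈ L, y = (x, leaf) ∨ y = (j * x, starTree j) ∨ y = (D * x, starTree D) := by
    intro y hy
    simp only [L, List.mem_append, List.mem_cons, List.mem_replicate] at hy
    tauto
  obtain ⟨W, T, hT, hreg, hnodes⟩ := exists_huffmanMerge_level (by omega : 0 < D) M x L
    (by simp [L, ← hpq]; ring)
    (by
      simp only [L, List.pairwise_append, List.pairwise_cons, List.pairwise_replicate,
        List.mem_replicate, List.mem_cons]
      refine ⟨.inr le_rfl, ⟨?_, .inr le_rfl⟩, ?_⟩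
      · rintro _ ⟨-, rfl⟩
        exact hjx
      · rintro _ ⟨-, rfl⟩ _ (rfl | ⟨-, rfl⟩)
        · exact hxj
        · exact hxj.trans hjx)
    (by
      intro y hy
      rcases hmem y hy with rfl | rfl | rfl
      · exact ⟨le_rfl, hxj.trans hjx⟩
      · exact ⟨hxj, hjx⟩
      · exact ⟨hxj.trans hjx, le_rfl⟩)
  refine ⟨T, .inr ⟨j, _, W, hj, hjD, ?_, .of_eq (List.replicate j (x, leaf))
    (Multiset.replicate (p + q * D) (x, leaf)) (by simp) ?_ ?_ rfl, ?_⟩, hreg, ?_⟩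
  -- The `1 ^ M` puts D ^ M - 1 in the form needed for divisibility by D - 1.
  · have h : ((n : ℤ) - j) = ((D : ℤ) ^ M - 1 ^ M) + q * (D - 1) := by
      have : (p + 1 + q : ℤ) = (D : ℤ) ^ M := by exact_mod_cast hpq
      rw [← this, hn]; push_cast; ring
    rw [h]
    exact dvd_add (sub_dvd_pow_sub_pow _ _ _) (Dvd.intro_left _ rfl)
  · intro s hs r hr
    rw [List.eq_of_mem_replicate hs, Multiset.eq_of_mem_replicate hr]
  · rw [initialForest_uniformDist, Multiset.coe_replicate, ← Multiset.replicate_add]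
    congr 1
    omega
  · refine ReflTransGen.trans ?_ hT
    have := huffmanMerge_replicate_leaf D x q
      ((j * x, starTree j) ::ₘ Multiset.replicate p (x, leaf))
      (by
        intro y hy
        rcases Multiset.mem_cons.1 hy with rfl | hy
        · exact hxj
        · rw [Multiset.eq_of_mem_replicate hy]) (hxj.trans hjx)
    convert this using 1
    · rw [Multiset.add_cons, ← Multiset.replicate_add, add_comm p]
      simp [starTree]
    · simp only [L]
      rw [← Multiset.coe_add, ← Multiset.cons_coe, Multiset.coe_replicate, Multiset.coe_replicate,
        Multiset.add_cons, Multiset.add_cons, add_comm]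
  · rw [hnodes]
    simp [L, levelList]

-- Arithmetic of the level counts and the main theorem

theorem exists_level_counts {D n : ℕ} (hD : 2 ≤ D) (hn : 2 ≤ n) :
    ∃ M p j q : ℕ, 2 ≤ j ∧ j ≤ D ∧ p + 1 + q = D ^ M ∧ n = p + j + q * D := by
  obtain ⟨d, rfl⟩ : ∃ d, D = d + 1 := ⟨D - 1, by omega⟩
  -- The logarithm is taken of n - 1, so that D ^ M < n ≤ D ^ (M + 1) and a power of D falls at the
  -- top of its range. Dividing n - 1 - D ^ M by D - 1 gives q, with remainder j - 2.
  obtain ⟨N, rfl⟩ : ∃ N, n = N + 1 := ⟨n - 1, by omega⟩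
  have h1 := Nat.pow_log_le_self (d + 1) (show N ≠ 0 by omega)
  have h2 := Nat.lt_pow_succ_log_self (b := d + 1) (by omega) N
  generalize Nat.log (d + 1) N = M at h1 h2
  obtain ⟨s, rfl⟩ := Nat.exists_eq_add_of_le h1
  have hdiv := Nat.div_add_mod s d
  have hmod := Nat.mod_lt s (show d > 0 by omega)
  have hq : s / d < (d + 1) ^ M := by
    rw [Nat.div_lt_iff_lt_mul (by omega)]
    rw [pow_succ] at h2
    nlinarith
  generalize s / d = q at hdiv hq
  obtain ⟨p, hp⟩ := Nat.exists_eq_add_of_lt hq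
  refine ⟨M, p, s % d + 2, q, by omega, by omega, by omega, ?_⟩
  rw [hp, ← hdiv]
  simp only [Nat.mul_add_mod, Nat.mod_mod]
  ring

/-- The numbers `a`, `r = n - D ^ m` and `c = ⌈r / (D - 1)⌉` for `D = d + 1`. -/
theorem exists_length_counts {d n m : ℕ} (hd : 1 ≤ d) (hm : (d + 1) ^ m ≤ n)
    (hm' : n < (d + 1) ^ (m + 1)) :
    ∃ a r c : ℕ, a + c = (d + 1) ^ m ∧ n = a + (r + c) ∧ r ≤ c * d ∧ c * d + 1 ≤ r + d ∧
      (a : ℤ) = ((d + 1 : ℕ) : ℤ) ^ m -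
        ⌈((n : ℚ) - ((d + 1 : ℕ) : ℚ) ^ m) / (((d + 1 : ℕ) : ℚ) - 1)⌉ ∧
      ∀ T : PlaneTree, T.IsUniformTree (d + 1) n →
        T.lengthSequence = List.replicate a m ++ List.replicate (r + c) (m + 1) := by
  have hceil : ∀ r c : ℕ, n = (d + 1) ^ m + r → r ≤ c * d → c * d + 1 ≤ r + d →
      ⌈((n : ℚ) - ((d + 1 : ℕ) : ℚ) ^ m) / (((d + 1 : ℕ) : ℚ) - 1)⌉ = c := by
    intro r c hn hrc hcr
    have hd' : (0 : ℚ) < d := by exact_mod_cast hd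
    have hrc' : (r : ℚ) ≤ c * d := by exact_mod_cast hrc
    have hcr' : (c * d + 1 : ℚ) ≤ r + d := by exact_mod_cast hcr
    have h1 : (n : ℚ) - ((d + 1 : ℕ) : ℚ) ^ m = r := by rw [hn]; push_cast; ring
    have h2 : ((d + 1 : ℕ) : ℚ) - 1 = d := by push_cast; ring
    rw [h1, h2, Int.ceil_eq_iff, lt_div_iff₀ hd', div_le_iff₀ hd']
    push_cast
    exact ⟨by nlinarith, hrc'⟩
  suffices h : ∃ a r c : ℕ, a + c = (d + 1) ^ m ∧ n = a + (r + c) ∧ r ≤ c * d ∧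
      c * d + 1 ≤ r + d ∧ ∀ T : PlaneTree, T.IsUniformTree (d + 1) n →
        T.leafLevels = List.replicate a m ++ List.replicate (r + c) (m + 1) by
    obtain ⟨a, r, c, hac, hn, hrc, hcr, hT⟩ := h
    refine ⟨a, r, c, hac, hn, hrc, hcr, ?_, fun T h => sort_coe_eq_replicate_append ?_⟩
    · rw [hceil r c (by omega) hrc hcr]
      have : (a + c : ℤ) = ((d + 1 : ℕ) : ℤ) ^ m := by exact_mod_cast hac
      rw [← this]; ring
    · rw [hT T h, ← Multiset.coe_add, Multiset.coe_replicate, Multiset.coe_replicate]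
  have hpos := Nat.one_le_pow m (d + 1) (by omega)
  rcases (hpos.trans hm).eq_or_lt with rfl | hn
  · obtain rfl : m = 0 := by
      by_contra h
      have := Nat.one_lt_pow h (show 1 < d + 1 by omega)
      omega
    refine ⟨1, 0, 0, rfl, rfl, by simp, by omega, fun T hT => ?_⟩
    rw [(isUniformTree_one_iff (by omega) T).1 hT]
    simp [leafLevels]
  · obtain ⟨M, p, j, q, hj, hjD, hpq, rfl⟩ := exists_level_counts (D := d + 1) (by omega) hn
    have hlev : ∀ T : PlaneTree, T.IsUniformTree (d + 1) (p + j + q * (d + 1)) →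
        T.leafLevels = List.replicate p M ++ List.replicate (j + q * (d + 1)) (M + 1) := by
      intro T hT
      obtain ⟨hreg, hT⟩ := (isUniformTree_iff hj hjD hpq T).1 hT
      exact leafLevels_of_nodesAt_eq_levelList (by omega) (by omega) hreg hT
    have hlow : (d + 1) ^ M < p + j + q * (d + 1) := by nlinarith
    have hup : p + j + q * (d + 1) ≤ (d + 1) ^ (M + 1) := by rw [pow_succ, ← hpq]; nlinarith
    have h1 : M < m + 1 := (Nat.pow_lt_pow_iff_right (by omega)).1 (hlow.trans hm')
    have h2 : m ≤ M + 1 := (Nat.pow_le_pow_iff_right (by omega)).1 (hm.trans hup)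
    -- The levels m and M differ exactly when n = D ^ (M + 1): then m = M + 1 and all leaves lie at
    -- level m.
    rcases h2.eq_or_lt with rfl | h2
    · have heq := hup.antisymm hm
      refine ⟨(d + 1) ^ (M + 1), 0, 0, rfl, heq, by simp, by omega, fun T hT => ?_⟩
      have hp : p = 0 := by
        rw [pow_succ, ← hpq] at heq
        nlinarith
      rw [hlev T hT, ← heq, hp]
      simp
    · obtain rfl : m = M := by omega
      -- Here c = q + 1 counts the internal nodes at level M; j ≤ D and 2 ≤ j give the two
      -- inequalities that characterise the ceiling.
      refine ⟨p, j - 1 + q * d, q + 1, by omega, ?_, ?_, ?_, fun T hT => ?_⟩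
      · rw [Nat.mul_succ]; omega
      · rw [Nat.succ_mul]; omega
      · rw [Nat.succ_mul]; omega
      · rw [hlev T hT]
        congr 2
        rw [Nat.mul_succ]; omega

theorem mainTheorem4 {A : Type*} [Fintype A] (D n : ℕ) (hA : Fintype.card A = D)
    (hD : 2 ≤ D) (hn : 1 ≤ n) :
    -- the tree `T_U` is well defined
    (∃! T : PlaneTree, T.IsUniformTree D n) ∧
    -- it is a Huffman tree for the uniform distribution
    (∀ T : PlaneTree, T.IsUniformTree D n → IsHuffmanTree D (uniformDist n) T) ∧
    -- its length sequence, which is the optimal length sequence for the uniform distribution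
    (∀ m : ℕ, D ^ m ≤ n → n < D ^ (m + 1) →
      ∃ a b : ℕ, (a : ℤ) = (D : ℤ) ^ m - ⌈((n : ℚ) - (D : ℚ) ^ m) / ((D : ℚ) - 1)⌉ ∧ a + b = n ∧
        (∀ T : PlaneTree, T.IsUniformTree D n →
          T.lengthSequence = List.replicate a m ++ List.replicate b (m + 1)) ∧
        (∀ L : List ℕ, IsOptimalLengthSequence A (uniformDist n) L ↔
          L = List.replicate a m ++ List.replicate b (m + 1))) := by
  refine ⟨?_, ?_, ?_⟩
  · rcases hn.eq_or_lt with rfl | hn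
    · exact ⟨leaf, (isUniformTree_one_iff hD _).2 rfl, fun T => (isUniformTree_one_iff hD T).1⟩
    · obtain ⟨M, p, j, q, hj, hjD, hpq, rfl⟩ := exists_level_counts hD hn
      -- The tree produced by the Huffman algorithm serves as the existence witness.
      obtain ⟨T, -, hreg, hT⟩ := exists_isHuffmanTree hj hjD hpq
      refine ⟨T, (isUniformTree_iff hj hjD hpq T).2 ⟨hreg, hT⟩, fun T' h' => ?_⟩
      obtain ⟨hreg', hT'⟩ := (isUniformTree_iff hj hjD hpq T').1 h'
      exact hreg'.ext hreg (hT'.trans hT.symm)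
  · intro T' h'
    rcases hn.eq_or_lt with rfl | hn
    · exact .inl ⟨rfl, (isUniformTree_one_iff hD T').1 h'⟩
    · obtain ⟨M, p, j, q, hj, hjD, hpq, rfl⟩ := exists_level_counts hD hn
      obtain ⟨T, hH, hreg, hT⟩ := exists_isHuffmanTree hj hjD hpq
      obtain ⟨hreg', hT'⟩ := (isUniformTree_iff hj hjD hpq T').1 h'
      rwa [hreg'.ext hreg (hT'.trans hT.symm)]
  · intro m hm hm'
    obtain ⟨d, rfl⟩ : ∃ d, D = d + 1 := ⟨D - 1, by omega⟩
    obtain ⟨a, r, c, hac, rfl, hrc, hcr, ha, hT⟩ := exists_length_counts (by omega) hm hm'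
    exact ⟨a, r + c, ha, rfl, hT,
      isOptimalLengthSequence_uniformDist_iff (by omega) hA hac hrc hcr hn⟩
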